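/- Let $n\in\mathbb N$, let $F:[0,+\infty)\to\mathbb R$ be continuous and bounded from below, and let $\omega\subset\mathbb R^n$ be a Lebesgue measurable set which is not dense in $\mathbb R^n$. Let $F(|D_x|)$, $D_x=-i\nabla_x$, be the Fourier multiplier on $L^2(\mathbb R^n)$ (complex-valued functions) with symbol $F(|\xi|)$ and domain $\{u\in L^2(\mathbb R^n): F(|\xi|)\,\widehat u\in L^2(\mathbb R^n)\}$, where $\widehat u(\xi)=\int e^{-ix\cdot\xi}u(x)\,dx$ (extended to $L^2$), and consider the control system $$(E_F)\qquad \partial_t f(t,x)+F(|D_x|)f(t,x)=h(t,x)\mathbf 1_\omega(x),\quad t>0,\ x\in\mathbb R^n,\qquad f(0,\cdot)=f_0\in L^2(\mathbb R^n).$$ For $\alpha\in\mathbb R$, $(E_F)$ is called exponentially stabilizable from $\omega$ at rate $\alpha$ if there exist $M\ge 1$ and a bounded linear operator $K$ on $L^2(\mathbb R^n)$ such that the strongly continuous semigroup $\big(e^{-t(F(|D_x|)+\mathbf 1_\omega K)}\big)_{t\ge0}$ generated by $-(F(|D_x|)+\mathbf 1_\omega K)$ satisfies $\big\|e^{-t(F(|D_x|)+\mathbf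 1_\omega K)}\big\|_{\mathcal L(L^2(\mathbb R^n))}\le M e^{-\alpha t}$ for all $t\ge 0$. It is called rapidly stabilizable from $\omega$ if it is exponentially stabilizable from $\omega$ at every rate $\alpha>0$. Assume that $\lim_{r\to+\infty}F(r)$ exists and is a non-negative real number. Then $F$ is bounded from above, and for every $\alpha>\sup F$ the system $(E_F)$ is not exponentially stabilizable from $\omega$ at rate $\alpha$. In particular, $(E_F)$ is not rapidly stabilizable from $\omega$. -/

import Mathlib

open MeasureTheory Filter Topology Set
open scoped NNReal ENNReal FourierTransform

noncomputable section

namespace FourierControl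

/-- The complex Hilbert space `L²(ℝⁿ)`, for the Lebesgue measure on Euclidean space. -/
abbrev L2 (n : ℕ) : Type :=
  Lp ℂ 2 (volume : Measure (EuclideanSpace ℝ (Fin n)))

/-- The symbol `ξ ↦ F(|ξ|)` of `F(|D|)`, `D = -i∇`, in the frequency variable of Mathlib's Fourier
transform `𝓕 u ξ = ∫ exp(-2πi x·ξ) u(x) dx`; in this variable `D` has symbol `2πξ`. -/
def radialSymbol {n : ℕ} (F : ℝ≥0 → ℝ) (ξ : EuclideanSpace ℝ (Fin n)) : ℂ :=
  (F ‖(2 * Real.pi) • ξ‖₊ : ℂ)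

theorem symbol_mul_fourier_zero {n : ℕ} (m : EuclideanSpace ℝ (Fin n) → ℂ) :
    (fun ξ => m ξ * (𝓕 (0 : L2 n) : L2 n) ξ) =ᵐ[volume] fun _ => (0 : ℂ) := by
  have h0 : (𝓕 (0 : L2 n) : L2 n) = 0 := map_zero (Lp.fourierTransformₗᵢ _ ℂ)
  rw [h0]
  filter_upwards [Lp.coeFn_zero ℂ 2 (volume : Measure (EuclideanSpace ℝ (Fin n)))] with ξ h
  rw [h, Pi.zero_apply, mul_zero]

theorem symbol_mul_fourier_add {n : ℕ} (m : EuclideanSpace ℝ (Fin n) → ℂ) (u v : L2 n) :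
    (fun ξ => m ξ * (𝓕 (u + v) : L2 n) ξ) =ᵐ[volume]
      (fun ξ => m ξ * (𝓕 u : L2 n) ξ) + fun ξ => m ξ * (𝓕 v : L2 n) ξ := by
  rw [FourierTransform.fourier_add]
  filter_upwards [Lp.coeFn_add (𝓕 u : L2 n) (𝓕 v : L2 n)] with ξ h
  rw [h, Pi.add_apply, Pi.add_apply, mul_add]

theorem symbol_mul_fourier_smul {n : ℕ} (m : EuclideanSpace ℝ (Fin n) → ℂ) (c : ℂ) (u : L2 n) :
    (fun ξ => m ξ * (𝓕 (c • u) : L2 n) ξ) =ᵐ[volume] c • fun ξ => m ξ * (𝓕 u : L2 n) ξ := by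
  rw [FourierTransform.fourier_smul]
  filter_upwards [Lp.coeFn_smul c (𝓕 u : L2 n)] with ξ h
  rw [h, Pi.smul_apply, Pi.smul_apply, smul_eq_mul, smul_eq_mul, mul_left_comm]

/-- The Fourier multiplier `F(|D|)`, as an unbounded operator on `L²(ℝⁿ)` with its maximal domain
`{u ∈ L² : F(|ξ|) û ∈ L²}`. -/
def fourierMultiplier {n : ℕ} (F : ℝ≥0 → ℝ) : L2 n →ₗ.[ℂ] L2 n where
  domain :=
    { carrier := {u | MemLp (fun ξ => radialSymbol F ξ * (𝓕 u : L2 n) ξ) 2 volume}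
      zero_mem' := (memLp_congr_ae (symbol_mul_fourier_zero _)).mpr MemLp.zero
      add_mem' := fun {u v} hu hv =>
        (memLp_congr_ae (symbol_mul_fourier_add _ u v)).mpr (MemLp.add hu hv)
      smul_mem' := fun c u hu =>
        (memLp_congr_ae (symbol_mul_fourier_smul _ c u)).mpr (MemLp.const_smul hu c) }
  toFun :=
    { toFun := fun u => 𝓕⁻ (MemLp.toLp _ u.2 : L2 n)
      map_add' := fun u v => by
        rw [← FourierTransform.fourierInv_add, ← MemLp.toLp_add]
        exact congrArg (fun w : L2 n => 𝓕⁻ w)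
          (MemLp.toLp_congr _ _ (symbol_mul_fourier_add _ (u : L2 n) v))
      map_smul' := fun c u => by
        rw [RingHom.id_apply, ← FourierTransform.fourierInv_smul, ← MemLp.toLp_const_smul]
        exact congrArg (fun w : L2 n => 𝓕⁻ w)
          (MemLp.toLp_congr _ _ (symbol_mul_fourier_smul _ c (u : L2 n))) }

theorem memLp_indicator {n : ℕ} {ω : Set (EuclideanSpace ℝ (Fin n))}
    (hω : NullMeasurableSet ω volume) (u : L2 n) : MemLp (ω.indicator u) 2 volume :=
  (Lp.memLp u).of_le ((Lp.aestronglyMeasurable u).indicator₀ hω)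
    (Eventually.of_forall fun _ => norm_indicator_le_norm_self _ _)

/-- Multiplication by the characteristic function of a Lebesgue measurable set `ω`, as a bounded
operator on `L²(ℝⁿ)`. -/
def indicatorMul {n : ℕ} {ω : Set (EuclideanSpace ℝ (Fin n))}
    (hω : NullMeasurableSet ω volume) : L2 n →L[ℂ] L2 n :=
  LinearMap.mkContinuous
    { toFun := fun u => MemLp.toLp _ (memLp_indicator hω u)
      map_add' := by
        intro u v
        rw [← MemLp.toLp_add]
        refine MemLp.toLp_congr _ _ ?_
        filter_upwards [Lp.coeFn_add u v] with x h
        by_cases hx : x ∈ ω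
        · simp only [Pi.add_apply, Set.indicator_of_mem hx]
          rw [h, Pi.add_apply]
        · simp only [Pi.add_apply, Set.indicator_of_notMem hx, add_zero]
      map_smul' := by
        intro c u
        rw [RingHom.id_apply, ← MemLp.toLp_const_smul]
        refine MemLp.toLp_congr _ _ ?_
        filter_upwards [Lp.coeFn_smul c u] with x h
        by_cases hx : x ∈ ω
        · simp only [Pi.smul_apply, Set.indicator_of_mem hx]
          rw [h, Pi.smul_apply]
        · simp only [Pi.smul_apply, Set.indicator_of_notMem hx, smul_zero] }
    1 (by
      intro u
      rw [one_mul]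
      refine Lp.norm_le_norm_of_ae_le ?_
      filter_upwards [MemLp.coeFn_toLp (memLp_indicator hω u)] with x h
      exact h ▸ norm_indicator_le_norm_self _ _)

/-- Strongly continuous one-parameter semigroups of bounded operators. -/
structure IsC0Semigroup {H : Type*} [NormedAddCommGroup H] [NormedSpace ℂ H]
    (S : ℝ≥0 → H →L[ℂ] H) : Prop where
  map_zero : S 0 = ContinuousLinearMap.id ℂ H
  map_add : ∀ s t, S (s + t) = (S s).comp (S t)
  continuous_orbit : ∀ u, Continuous fun t => S t u

/-- `A` is the infinitesimal generator of `S`: `u` belongs to the domain of `A` with `A u = v` if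
and only if `(S h u - u) / h → v` as `h → 0⁺`. -/
def IsGenerator {H : Type*} [NormedAddCommGroup H] [NormedSpace ℂ H]
    (S : ℝ≥0 → H →L[ℂ] H) (A : H →ₗ.[ℂ] H) : Prop :=
  ∀ u v : H, (u, v) ∈ A.graph ↔
    Tendsto (fun h : ℝ≥0 => ((h : ℝ) : ℂ)⁻¹ • (S h u - u)) (𝓝[>] 0) (𝓝 v)

/-- The closed-loop operator `F(|D|) + 1_ω K`, with the domain of `F(|D|)`. -/
def closedLoop {n : ℕ} (F : ℝ≥0 → ℝ) {ω : Set (EuclideanSpace ℝ (Fin n))}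
    (hω : NullMeasurableSet ω volume) (K : L2 n →L[ℂ] L2 n) : L2 n →ₗ.[ℂ] L2 n :=
  (((indicatorMul hω).comp K : L2 n →L[ℂ] L2 n) : L2 n →ₗ[ℂ] L2 n) +ᵥ fourierMultiplier F

/-- The system `∂ₜ f + F(|D|) f = h 1_ω` is exponentially stabilizable from `ω` at rate `α`: for some
bounded feedback `K` on `L²(ℝⁿ)` and some `M ≥ 1`, the semigroup `S t = exp(-t (F(|D|) + 1_ω K))`
satisfies `‖S t‖ ≤ M exp(-α t)` for all `t ≥ 0`. -/
def ExpStabilizableAtRate {n : ℕ} (F : ℝ≥0 → ℝ) {ω : Set (EuclideanSpace ℝ (Fin n))}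
    (hω : NullMeasurableSet ω volume) (α : ℝ) : Prop :=
  ∃ M : ℝ, 1 ≤ M ∧ ∃ K : L2 n →L[ℂ] L2 n, ∃ S : ℝ≥0 → L2 n →L[ℂ] L2 n,
    IsC0Semigroup S ∧ IsGenerator S (-closedLoop F hω K) ∧
      ∀ t : ℝ≥0, ‖S t‖ ≤ M * Real.exp (-α * t)

/-- Rapid stabilizability: exponential stabilizability at every rate `α > 0`. -/
def RapidlyStabilizable {n : ℕ} (F : ℝ≥0 → ℝ) {ω : Set (EuclideanSpace ℝ (Fin n))}
    (hω : NullMeasurableSet ω volume) : Prop :=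
  ∀ α : ℝ, 0 < α → ExpStabilizableAtRate F hω α

end FourierControl

end

/-!
A symbol `F` with a finite limit `L` at infinity is bounded, so `F(|D|)` and every closed-loop
operator `B = F(|D|) + 1_ω K` are everywhere defined. The obstruction to fast decay comes from
approximate eigenvectors of the adjoint `B* = F(|D|) + K* 1_ω`. A function `g` vanishing on `ω`
satisfies `B* g = F(|D|) g`, whatever the feedback `K` is. As `ω` is not dense, there is a bump
function `χ` supported off `ω`; its modulations `g_k(x) = exp(2πi k x·e) χ(x)` all have the same
norm, and their Fourier transforms are the translates of that of `χ` by `k e`. By dominated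
convergence `(F(|D|) - L) g_k → 0` (`tendsto_integral_symbol_sub_mul_fourier`). In dimension `0`,
where frequencies cannot be sent to infinity, `F(0)` plays the role of `L`; both values are at most
`sup F` (`exists_tendsto_radialSymbol_add_nsmul`).

If the semigroup decayed at a rate `α > sup F`, then differentiating `exp(L t) ⟪g_k, S t g_k⟫` and
integrating over `[0, ∞)` would bound `‖g_k‖²` by a constant times `‖(F(|D|) - L) g_k‖`
(`norm_sq_le_of_approx_eigenvector`), which tends to `0`. Adjoints are only used in weak form,
through inner products, and only right derivatives of the orbits are needed.
-/

namespace FourierControl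

/-! ### Decay of a semigroup and approximate eigenvectors of the adjoint generator -/

section Semigroup

variable {H : Type*} [NormedAddCommGroup H]

/-- The orbits have right derivatives at every time, by the semigroup law. -/
theorem IsC0Semigroup.hasDerivWithinAt_orbit [NormedSpace ℂ H] {S : ℝ≥0 → H →L[ℂ] H}
    (hS : IsC0Semigroup S) {u v : H} {t : ℝ} (ht : 0 ≤ t)
    (hv : Tendsto (fun h : ℝ≥0 => ((h : ℝ) : ℂ)⁻¹ • (S h (S t.toNNReal u) - S t.toNNReal u))
      (𝓝[>] 0) (𝓝 v)) :
    HasDerivWithinAt (fun s : ℝ => S s.toNNReal u) v (Ici t) t := by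
  rw [← hasDerivWithinAt_Ioi_iff_Ici, hasDerivWithinAt_iff_tendsto_slope' self_notMem_Ioi]
  have hshift : Tendsto (fun s : ℝ => (s - t).toNNReal) (𝓝[>] t) (𝓝[>] 0) := by
    refine tendsto_nhdsWithin_of_tendsto_nhds_of_eventually_within _ ?_ ?_
    · have : Continuous fun s : ℝ => (s - t).toNNReal := by fun_prop
      simpa using (this.tendsto t).mono_left nhdsWithin_le_nhds
    · filter_upwards [self_mem_nhdsWithin] with s hs
      simpa using hs
  refine (hv.comp hshift).congr' ?_
  filter_upwards [self_mem_nhdsWithin] with s hs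
  have hst : 0 ≤ s - t := (sub_pos.mpr hs).le
  have hadd : s.toNNReal = (s - t).toNNReal + t.toNNReal := by
    rw [← Real.toNNReal_add hst ht, sub_add_cancel]
  rw [slope_def_module, hadd, hS.map_add, Function.comp_apply, Real.coe_toNNReal _ hst,
    ContinuousLinearMap.comp_apply, ← Complex.ofReal_inv, Complex.coe_smul]

/-- If `g` is an `ε`-approximate eigenvector of `B*` for the real value `lam`, in the weak form
`|⟪g, B v⟫ - lam ⟪g, v⟫| ≤ ε ‖v‖`, and the semigroup generated by `-B` decays at a rate
`α > lam`, then `‖g‖` is small: `φ t = exp (lam t) ⟪g, S t g⟫` starts at `‖g‖²`, tends to `0`, and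
its derivative is at most `ε M ‖g‖ exp (-(α - lam) t)` in modulus. -/
theorem norm_sq_le_of_approx_eigenvector [InnerProductSpace ℂ H] {S : ℝ≥0 → H →L[ℂ] H}
    (hS : IsC0Semigroup S) {B : H → H}
    (hB : ∀ u, Tendsto (fun h : ℝ≥0 => ((h : ℝ) : ℂ)⁻¹ • (S h u - u)) (𝓝[>] 0) (𝓝 (-B u)))
    {M α lam ε : ℝ} (hlam : lam < α) (hdecay : ∀ t : ℝ≥0, ‖S t‖ ≤ M * Real.exp (-α * t))
    (hε : 0 ≤ ε) {g : H} (hg : ∀ v, ‖inner ℂ g (B v) - lam * inner ℂ g v‖ ≤ ε * ‖v‖) :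
    ‖g‖ ^ 2 ≤ ε * M * ‖g‖ / (α - lam) := by
  set δ := α - lam with hδ
  have hδ0 : 0 < δ := sub_pos.mpr hlam
  have hexp (t : ℝ) : Real.exp (lam * t) * Real.exp (-α * t) = Real.exp (-δ * t) := by
    rw [← Real.exp_add, hδ]
    congr 1
    ring
  have horbit {t : ℝ} (ht : 0 ≤ t) : ‖S t.toNNReal g‖ ≤ M * Real.exp (-α * t) * ‖g‖ := by
    refine (S t.toNNReal).le_of_opNorm_le ?_ g
    simpa [Real.coe_toNNReal _ ht] using hdecay t.toNNReal
  set φ : ℝ → ℂ := fun t => (Real.exp (lam * t) : ℂ) * inner ℂ g (S t.toNNReal g) with hφ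
  set φ' : ℝ → ℂ := fun t => (Real.exp (lam * t) : ℂ) *
    -(inner ℂ g (B (S t.toNNReal g)) - lam * inner ℂ g (S t.toNNReal g)) with hφ'
  have hφ0 : φ 0 = (‖g‖ : ℂ) ^ 2 := by
    simp [hφ, hS.map_zero, inner_self_eq_norm_sq_to_K]
  have hφcont : Continuous φ := by
    have h1 : Continuous fun t : ℝ => S t.toNNReal g :=
      (hS.continuous_orbit g).comp continuous_real_toNNReal
    exact (Complex.continuous_ofReal.comp (by fun_prop)).mul (continuous_const.inner h1)
  have hφderiv {t : ℝ} (ht : 0 ≤ t) : HasDerivWithinAt φ (φ' t) (Ici t) t := by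
    have h1 := hS.hasDerivWithinAt_orbit ht (hB (S t.toNNReal g))
    have h2 : HasDerivWithinAt (fun s : ℝ => inner ℂ g (S s.toNNReal g))
        (inner ℂ g (-B (S t.toNNReal g))) (Ici t) t :=
      ((innerSL ℂ g).restrictScalars ℝ).hasFDerivAt.comp_hasDerivWithinAt t h1
    have h3 : HasDerivAt (fun s : ℝ => (Real.exp (lam * s) : ℂ))
        ((Real.exp (lam * t) * lam : ℝ) : ℂ) t := by
      have h4 := ((hasDerivAt_id t).const_mul lam).exp
      simpa using h4.ofReal_comp
    refine (h3.hasDerivWithinAt.mul h2).congr_deriv ?_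
    rw [hφ', inner_neg_right]
    push_cast
    ring
  have hφbound {t : ℝ} (ht : 0 ≤ t) : ‖φ' t‖ ≤ ε * M * ‖g‖ * Real.exp (-δ * t) := by
    rw [hφ', norm_mul, norm_neg, Complex.norm_real, Real.norm_of_nonneg (Real.exp_pos _).le]
    calc Real.exp (lam * t) *
          ‖inner ℂ g (B (S t.toNNReal g)) - lam * inner ℂ g (S t.toNNReal g)‖
        ≤ Real.exp (lam * t) * (ε * (M * Real.exp (-α * t) * ‖g‖)) := by
          gcongr
          exact (hg _).trans (by gcongr; exact horbit ht)
      _ = ε * M * ‖g‖ * Real.exp (-δ * t) := by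
          rw [← hexp]
          ring
  -- The comparison function is the primitive of the bound on `φ'` that vanishes at `0`.
  have hprimitive (t : ℝ) :
      HasDerivAt (fun s => ε * M * ‖g‖ / δ * (1 - Real.exp (-δ * s)))
        (ε * M * ‖g‖ * Real.exp (-δ * t)) t := by
    have h1 := ((((hasDerivAt_id t).const_mul (-δ)).exp).const_sub 1).const_mul (ε * M * ‖g‖ / δ)
    refine h1.congr_deriv ?_
    simp only [id]
    field_simp
  have hM : 0 ≤ M := by simpa using (norm_nonneg _).trans (hdecay 0)
  have hmain {t : ℝ} (ht : 0 ≤ t) :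
      ‖g‖ ^ 2 ≤ ε * M * ‖g‖ / δ + M * ‖g‖ ^ 2 * Real.exp (-δ * t) := by
    have h1 : ‖φ t - φ 0‖ ≤ ε * M * ‖g‖ / δ * (1 - Real.exp (-δ * t)) :=
      image_norm_le_of_norm_deriv_right_le_deriv_boundary (a := 0) (b := t)
        (hφcont.sub continuous_const).continuousOn
        (fun x hx => (hφderiv hx.1).sub_const _) (by simp [hφ]) hprimitive
        (fun x hx => hφbound hx.1) (right_mem_Icc.mpr ht)
    have h2 : ‖φ t‖ ≤ M * ‖g‖ ^ 2 * Real.exp (-δ * t) := by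
      rw [hφ, norm_mul, Complex.norm_real, Real.norm_of_nonneg (Real.exp_pos _).le]
      calc Real.exp (lam * t) * ‖inner ℂ g (S t.toNNReal g)‖
          ≤ Real.exp (lam * t) * (‖g‖ * (M * Real.exp (-α * t) * ‖g‖)) := by
            gcongr
            exact (norm_inner_le_norm _ _).trans (by gcongr; exact horbit ht)
        _ = M * ‖g‖ ^ 2 * Real.exp (-δ * t) := by
            rw [← hexp]
            ring
    have h3 : ‖φ 0‖ = ‖g‖ ^ 2 := by simp [hφ0]
    have h4 : ‖φ 0‖ ≤ ‖φ t‖ + ‖φ t - φ 0‖ := norm_le_norm_add_norm_sub _ _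
    have h5 : 0 ≤ ε * M * ‖g‖ / δ := by positivity
    nlinarith [Real.exp_pos (-δ * t)]
  have hlim : Tendsto (fun t : ℝ => ε * M * ‖g‖ / δ + M * ‖g‖ ^ 2 * Real.exp (-δ * t)) atTop
      (𝓝 (ε * M * ‖g‖ / δ + M * ‖g‖ ^ 2 * 0)) := by
    refine ((Real.tendsto_exp_atBot.comp ?_).const_mul _).const_add _
    exact tendsto_id.const_mul_atTop_of_neg (neg_lt_zero.mpr hδ0)
  rw [mul_zero, add_zero] at hlim
  exact ge_of_tendsto hlim ((eventually_ge_atTop 0).mono fun t ht => hmain ht)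

end Semigroup

/-! ### Modulated bump functions and their Fourier transforms -/

section Frequency

variable {n : ℕ}

/-- A smooth bump function modulated to the frequency `η`: `x ↦ exp(2πi x·η) χ(x)`. -/
noncomputable def modulatedBump {c : EuclideanSpace ℝ (Fin n)} (χ : ContDiffBump c)
    (η : EuclideanSpace ℝ (Fin n)) : SchwartzMap (EuclideanSpace ℝ (Fin n)) ℂ :=
  HasCompactSupport.toSchwartzMap
    (f := fun x => Complex.exp ((2 * Real.pi * inner ℝ x η : ℝ) * Complex.I) * (χ x : ℂ))
    ((χ.hasCompactSupport.comp_left (g := fun r : ℝ => (r : ℂ)) Complex.ofReal_zero).mul_left)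
    (by
      have h1 : ContDiff ℝ (⊤ : ℕ∞) fun x => (χ x : ℂ) := Complex.ofRealCLM.contDiff.comp χ.contDiff
      have h2 : ContDiff ℝ (⊤ : ℕ∞) fun x : EuclideanSpace ℝ (Fin n) =>
          Complex.exp ((2 * Real.pi * inner ℝ x η : ℝ) * Complex.I) :=
        ((Complex.ofRealCLM.contDiff.comp
          (contDiff_const.mul (contDiff_id.inner ℝ contDiff_const))).mul contDiff_const).cexp
      exact h2.mul h1)

theorem modulatedBump_apply {c : EuclideanSpace ℝ (Fin n)} (χ : ContDiffBump c)
    (η x : EuclideanSpace ℝ (Fin n)) : modulatedBump χ η x =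
      Complex.exp ((2 * Real.pi * inner ℝ x η : ℝ) * Complex.I) * (χ x : ℂ) := rfl

theorem norm_modulatedBump_apply {c : EuclideanSpace ℝ (Fin n)} (χ : ContDiffBump c)
    (η x : EuclideanSpace ℝ (Fin n)) : ‖modulatedBump χ η x‖ = ‖χ x‖ := by
  rw [modulatedBump_apply, norm_mul, Complex.norm_exp_ofReal_mul_I, one_mul, Complex.norm_real]

/-- Modulation becomes translation on the Fourier side. -/
theorem fourier_modulatedBump {c : EuclideanSpace ℝ (Fin n)} (χ : ContDiffBump c)
    (η ξ : EuclideanSpace ℝ (Fin n)) :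
    𝓕 (modulatedBump χ η) ξ = 𝓕 (modulatedBump χ 0) (ξ - η) := by
  rw [SchwartzMap.fourier_coe, SchwartzMap.fourier_coe, Real.fourier_eq', Real.fourier_eq']
  congr 1
  ext x
  simp only [modulatedBump_apply, smul_eq_mul, ← mul_assoc, ← Complex.exp_add, inner_sub_right,
    inner_zero_right]
  congr 2
  push_cast
  ring

theorem norm_toLp_modulatedBump {c : EuclideanSpace ℝ (Fin n)} (χ : ContDiffBump c)
    (η : EuclideanSpace ℝ (Fin n)) :
    ‖((modulatedBump χ η).toLp 2 : L2 n)‖ = ‖((modulatedBump χ 0).toLp 2 : L2 n)‖ := by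
  rw [SchwartzMap.norm_toLp, SchwartzMap.norm_toLp]
  congr 1
  exact eLpNorm_congr_norm_ae <| .of_forall fun x => by
    rw [norm_modulatedBump_apply, norm_modulatedBump_apply]

theorem toLp_modulatedBump_ne_zero {c : EuclideanSpace ℝ (Fin n)} (χ : ContDiffBump c)
    (η : EuclideanSpace ℝ (Fin n)) : ((modulatedBump χ η).toLp 2 : L2 n) ≠ 0 := by
  intro h
  have h0 : modulatedBump χ η = 0 :=
    SchwartzMap.injective_toLp 2 volume (h.trans (map_zero (SchwartzMap.toLpCLM ℂ ℂ 2 volume)).symm)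
  have h1 := norm_modulatedBump_apply χ η c
  rw [h0, χ.one_of_mem_closedBall (Metric.mem_closedBall_self χ.rIn_pos.le)] at h1
  simp at h1

theorem norm_sq_eq_integral (u : L2 n) : ‖u‖ ^ 2 = ∫ ξ, ‖u ξ‖ ^ 2 := by
  have h := L2.inner_def (𝕜 := ℂ) u u
  simp only [inner_self_eq_norm_sq_to_K] at h
  exact_mod_cast h

theorem continuous_radialSymbol {F : ℝ≥0 → ℝ} (hF : Continuous F) :
    Continuous (radialSymbol F : EuclideanSpace ℝ (Fin n) → ℂ) := by
  unfold radialSymbol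
  fun_prop

theorem memLp_radialSymbol_mul {F : ℝ≥0 → ℝ} (hF : Continuous F) {C : ℝ} (hC : ∀ r, |F r| ≤ C)
    (u : L2 n) : MemLp (fun ξ => radialSymbol F ξ * u ξ) 2 volume := by
  refine (Lp.memLp u).of_le_mul (c := C)
    ((continuous_radialSymbol hF).aestronglyMeasurable.mul (Lp.aestronglyMeasurable u))
    (.of_forall fun ξ => ?_)
  rw [norm_mul]
  gcongr
  simpa [radialSymbol] using hC _

theorem mem_fourierMultiplier_domain {F : ℝ≥0 → ℝ} (hF : Continuous F) {C : ℝ}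
    (hC : ∀ r, |F r| ≤ C) (u : L2 n) : u ∈ (fourierMultiplier F : L2 n →ₗ.[ℂ] L2 n).domain :=
  memLp_radialSymbol_mul hF hC _

/-- The modulated bumps become approximate eigenvectors of `F(|D|)`: translating the frequency
variable by `k e` moves the modulation from the bump to the symbol, and dominated convergence
applies. -/
theorem tendsto_integral_symbol_sub_mul_fourier {F : ℝ≥0 → ℝ} (hF : Continuous F) {C : ℝ}
    (hC : ∀ r, |F r| ≤ C) {lam : ℝ} {e : EuclideanSpace ℝ (Fin n)}
    (he : ∀ ξ : EuclideanSpace ℝ (Fin n),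
      Tendsto (fun k : ℕ => radialSymbol F (ξ + k • e)) atTop (𝓝 (lam : ℂ)))
    {c : EuclideanSpace ℝ (Fin n)} (χ : ContDiffBump c) :
    Tendsto (fun k : ℕ => ∫ ξ, ‖(radialSymbol F ξ - lam) *
      (𝓕 ((modulatedBump χ (k • e)).toLp 2) : L2 n) ξ‖ ^ 2) atTop (𝓝 0) := by
  have hint (k : ℕ) : ∫ ξ, ‖(radialSymbol F ξ - lam) *
      (𝓕 ((modulatedBump χ (k • e)).toLp 2) : L2 n) ξ‖ ^ 2 =
      ∫ ξ, ‖(radialSymbol F (ξ + k • e) - lam) * 𝓕 (modulatedBump χ 0) ξ‖ ^ 2 := by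
    rw [← integral_add_right_eq_self
      (fun ξ => ‖(radialSymbol F (ξ + k • e) - lam) * 𝓕 (modulatedBump χ 0) ξ‖ ^ 2) (-(k • e))]
    refine integral_congr_ae ?_
    rw [SchwartzMap.toLp_fourier_eq]
    filter_upwards [(𝓕 (modulatedBump χ (k • e))).coeFn_toLp 2 volume] with ξ h
    rw [h, fourier_modulatedBump, neg_add_cancel_right, sub_eq_add_neg ξ]
  simp_rw [hint]
  have hmem := (𝓕 (modulatedBump χ 0)).memLp 2 volume
  have hdom : Integrable (fun ξ => ((C + |lam|) * ‖𝓕 (modulatedBump χ 0) ξ‖) ^ 2) volume :=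
    (hmem.norm.const_mul (C + |lam|)).integrable_sq
  have h0 : (0 : ℝ) = ∫ _ : EuclideanSpace ℝ (Fin n), (0 : ℝ) := by simp
  rw [h0]
  refine tendsto_integral_of_dominated_convergence _ (fun k => ?_) hdom (fun k => ?_) ?_
  · have h1 := continuous_radialSymbol (n := n) hF
    have h2 := (𝓕 (modulatedBump χ 0)).continuous
    exact Continuous.aestronglyMeasurable (by fun_prop)
  · refine .of_forall fun ξ => ?_
    rw [norm_pow, norm_norm, norm_mul]
    gcongr
    refine (norm_sub_le _ _).trans ?_
    gcongr
    · simpa [radialSymbol] using hC _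
    · simp
  · refine .of_forall fun ξ => ?_
    have h1 := (((he ξ).sub_const (lam : ℂ)).mul_const (𝓕 (modulatedBump χ 0) ξ)).norm.pow 2
    simpa using h1

end Frequency

/-! ### Closed-loop operators and high frequencies off the control set -/

section ClosedLoop

variable {n : ℕ} {ω : Set (EuclideanSpace ℝ (Fin n))}

theorem inner_indicatorMul_eq_zero (hω : NullMeasurableSet ω volume) {g : L2 n}
    (hg : ∀ᵐ x, x ∈ ω → g x = 0) (v : L2 n) : inner ℂ g (indicatorMul hω v) = 0 := by
  rw [L2.inner_def]
  refine integral_eq_zero_of_ae ?_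
  have h : indicatorMul hω v =ᵐ[volume] ω.indicator v := MemLp.coeFn_toLp (memLp_indicator hω v)
  filter_upwards [hg, h] with x hx hv
  rw [hv]
  by_cases hxω : x ∈ ω
  · simp [hx hxω]
  · simp [hxω]

/-- A weak bound on `(F(|D|) - lam)* g`, which on the Fourier side is `𝓕 g` multiplied by the real
symbol `F(|ξ|) - lam`. -/
theorem norm_inner_fourierMultiplier_sub_le {F : ℝ≥0 → ℝ} (hF : Continuous F) {C : ℝ}
    (hC : ∀ r, |F r| ≤ C) (lam : ℝ) (g : L2 n)
    (v : (fourierMultiplier F : L2 n →ₗ.[ℂ] L2 n).domain) :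
    ‖inner ℂ g (fourierMultiplier F v) - lam * inner ℂ g (v : L2 n)‖ ≤
      √(∫ ξ, ‖(radialSymbol F ξ - lam) * (𝓕 g : L2 n) ξ‖ ^ 2) * ‖(v : L2 n)‖ := by
  have hw : MemLp (fun ξ => (radialSymbol F ξ - lam) * (𝓕 g : L2 n) ξ) 2 volume := by
    simp only [sub_mul]
    exact (memLp_radialSymbol_mul hF hC _).sub ((Lp.memLp (𝓕 g : L2 n)).const_mul _)
  have hnorm : √(∫ ξ, ‖(radialSymbol F ξ - lam) * (𝓕 g : L2 n) ξ‖ ^ 2) = ‖hw.toLp‖ := by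
    rw [← Real.sqrt_sq (norm_nonneg hw.toLp), norm_sq_eq_integral]
    congr 1
    refine integral_congr_ae ?_
    filter_upwards [hw.coeFn_toLp] with ξ h
    rw [h]
  have hAv : 𝓕 (fourierMultiplier F v) = MemLp.toLp _ v.2 :=
    FourierTransform.fourier_fourierInv_eq _
  have hinner : inner ℂ g (fourierMultiplier F v) - lam * inner ℂ g (v : L2 n) =
      inner ℂ hw.toLp (𝓕 (v : L2 n)) := by
    rw [← Lp.inner_fourier_eq g, ← Lp.inner_fourier_eq g, hAv, ← inner_smul_right,
      ← inner_sub_right, L2.inner_def, L2.inner_def]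
    refine integral_congr_ae ?_
    filter_upwards [hw.coeFn_toLp, MemLp.coeFn_toLp v.2,
      Lp.coeFn_sub (MemLp.toLp _ v.2) ((lam : ℂ) • 𝓕 (v : L2 n)),
      Lp.coeFn_smul (lam : ℂ) (𝓕 (v : L2 n))] with ξ h1 h2 h3 h4
    rw [h1, h3, Pi.sub_apply, h2, h4]
    simp only [radialSymbol, Pi.smul_apply, smul_eq_mul, RCLike.inner_apply, map_mul, map_sub,
      Complex.conj_ofReal]
    ring
  rw [hinner, hnorm, ← Lp.norm_fourier_eq (v : L2 n)]
  exact norm_inner_le_norm _ _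

/-- Modulated bumps supported off `ω` are approximate eigenvectors, for the value `lam`, of the
adjoint of every closed-loop operator: they are not seen by the feedback, and modulation moves
their frequencies to where the symbol is close to `lam`. This rules out decay at a rate above
`lam`. -/
theorem not_expStabilizableAtRate_of_tendsto {F : ℝ≥0 → ℝ} (hF : Continuous F) {C : ℝ}
    (hC : ∀ r, |F r| ≤ C) (hω : NullMeasurableSet ω volume) (hdense : ¬ Dense ω)
    {lam α : ℝ} (hlam : lam < α) {e : EuclideanSpace ℝ (Fin n)}
    (he : ∀ ξ : EuclideanSpace ℝ (Fin n),
      Tendsto (fun k : ℕ => radialSymbol F (ξ + k • e)) atTop (𝓝 (lam : ℂ))) :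
    ¬ ExpStabilizableAtRate F hω α := by
  rintro ⟨M, -, K, S, hS, hgen, hdecay⟩
  obtain ⟨c, r, hr, hball⟩ : ∃ c, ∃ r > 0, Metric.ball c r ⊆ ωᶜ := by
    obtain ⟨c, hc⟩ := not_forall.mp hdense
    obtain ⟨r, hr, hball⟩ := Metric.isOpen_iff.mp isClosed_closure.isOpen_compl c hc
    exact ⟨c, r, hr, hball.trans (compl_subset_compl.mpr subset_closure)⟩
  let χ : ContDiffBump c := ⟨r / 2, r, half_pos hr, half_lt_self hr⟩
  let g : ℕ → L2 n := fun k => (modulatedBump χ (k • e)).toLp 2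
  let B : L2 n → L2 n := fun u =>
    closedLoop F hω K ⟨u, mem_fourierMultiplier_domain hF hC u⟩
  have hB (u : L2 n) :
      Tendsto (fun h : ℝ≥0 => ((h : ℝ) : ℂ)⁻¹ • (S h u - u)) (𝓝[>] 0) (𝓝 (-B u)) :=
    (hgen u (-B u)).mp
      ((-closedLoop F hω K).mem_graph ⟨u, mem_fourierMultiplier_domain hF hC u⟩)
  let ε : ℕ → ℝ := fun k => √(∫ ξ, ‖(radialSymbol F ξ - lam) * (𝓕 (g k) : L2 n) ξ‖ ^ 2)
  have hε : Tendsto ε atTop (𝓝 0) := by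
    have h := (tendsto_integral_symbol_sub_mul_fourier hF hC he χ).sqrt
    rwa [Real.sqrt_zero] at h
  have hoff (k : ℕ) : ∀ᵐ x, x ∈ ω → g k x = 0 := by
    filter_upwards [(modulatedBump χ (k • e)).coeFn_toLp 2 volume] with x hx hxω
    rw [hx, modulatedBump_apply, χ.zero_of_le_dist, Complex.ofReal_zero, mul_zero]
    exact not_lt.mp fun h => hball h hxω
  have happrox (k : ℕ) (v : L2 n) :
      ‖inner ℂ (g k) (B v) - lam * inner ℂ (g k) v‖ ≤ ε k * ‖v‖ := by
    have h1 : B v = indicatorMul hω (K v) +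
        fourierMultiplier F ⟨v, mem_fourierMultiplier_domain hF hC v⟩ := rfl
    rw [h1, inner_add_right, inner_indicatorMul_eq_zero hω (hoff k), zero_add]
    exact norm_inner_fourierMultiplier_sub_le hF hC lam (g k)
      ⟨v, mem_fourierMultiplier_domain hF hC v⟩
  have hle (k : ℕ) : ‖g 0‖ ^ 2 ≤ ε k * M * ‖g 0‖ / (α - lam) := by
    have h1 := norm_sq_le_of_approx_eigenvector hS hB hlam hdecay (Real.sqrt_nonneg _) (happrox k)
    have h2 : ‖g k‖ = ‖g 0‖ :=
      (norm_toLp_modulatedBump χ _).trans (norm_toLp_modulatedBump χ _).symm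
    rwa [h2] at h1
  have hlim := ((hε.mul_const M).mul_const ‖g 0‖).div_const (α - lam)
  rw [zero_mul, zero_mul, zero_div] at hlim
  have hpos : 0 < ‖g 0‖ := norm_pos_iff.mpr (toLp_modulatedBump_ne_zero χ _)
  exact (ge_of_tendsto' hlim hle).not_gt (by positivity)

/-- The symbol has a limit along a sequence of frequency shifts. In dimension `0` the only frequency
is `0`, so the limit is `F 0`; otherwise the frequency can be sent to infinity along any
direction. -/
theorem exists_tendsto_radialSymbol_add_nsmul (n : ℕ) {F : ℝ≥0 → ℝ} (hbdd : BddAbove (range F))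
    {L : ℝ} (hlim : Tendsto F atTop (𝓝 L)) :
    ∃ lam ≤ ⨆ r, F r, ∃ e : EuclideanSpace ℝ (Fin n), ∀ ξ : EuclideanSpace ℝ (Fin n),
      Tendsto (fun k : ℕ => radialSymbol F (ξ + k • e)) atTop (𝓝 (lam : ℂ)) := by
  rcases subsingleton_or_nontrivial (EuclideanSpace ℝ (Fin n)) with h | h
  · refine ⟨F 0, le_ciSup hbdd 0, 0, fun ξ => ?_⟩
    rw [Subsingleton.elim ξ 0]
    simp [radialSymbol]
  · obtain ⟨e, he⟩ := exists_ne (0 : EuclideanSpace ℝ (Fin n))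
    refine ⟨L, le_of_tendsto' hlim fun r => le_ciSup hbdd r, e, fun ξ => ?_⟩
    refine (Complex.continuous_ofReal.tendsto L).comp (hlim.comp ?_)
    rw [← NNReal.tendsto_coe_atTop]
    have h1 : Tendsto (fun k : ℕ => 2 * Real.pi * ((k : ℝ) * ‖e‖ - ‖ξ‖)) atTop atTop := by
      refine Tendsto.const_mul_atTop (by positivity) (tendsto_atTop_add_const_right _ _ ?_)
      exact tendsto_natCast_atTop_atTop.atTop_mul_const (norm_pos_iff.mpr he)
    refine tendsto_atTop_mono (fun k => ?_) h1
    rw [coe_nnnorm, norm_smul, Real.norm_of_nonneg (by positivity)]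
    gcongr
    have h2 := norm_sub_norm_le (k • e) (-ξ)
    rw [sub_neg_eq_add, add_comm (k • e), norm_neg, ← Nat.cast_smul_eq_nsmul ℝ,
      norm_smul, Real.norm_natCast, Nat.cast_smul_eq_nsmul] at h2
    linarith

end ClosedLoop
end FourierControl

theorem mainTheorem6 (n : ℕ) (F : ℝ≥0 → ℝ) (hF : Continuous F) (hbdd : BddBelow (Set.range F))
    (ω : Set (EuclideanSpace ℝ (Fin n))) (hω : NullMeasurableSet ω volume) (hdense : ¬ Dense ω)
    (L : ℝ) (hL : 0 ≤ L) (hlim : Tendsto F atTop (𝓝 L)) :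
    BddAbove (Set.range F) ∧
      (∀ α : ℝ, (⨆ r, F r) < α → ¬ FourierControl.ExpStabilizableAtRate F hω α) ∧
      ¬ FourierControl.RapidlyStabilizable F hω := by
  have habove : BddAbove (range F) := by
    obtain ⟨R, hR⟩ := eventually_atTop.mp (hlim.eventually_le_const (lt_add_one L))
    obtain ⟨b, hb⟩ := (isCompact_Icc (a := 0) (b := R)).bddAbove_image hF.continuousOn
    refine ⟨max b (L + 1), forall_mem_range.mpr fun r => ?_⟩
    rcases le_total r R with h | h
    · exact le_max_of_le_left (hb (mem_image_of_mem F ⟨zero_le, h⟩))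
    · exact le_max_of_le_right (hR r h)
  have hmain (α : ℝ) (hα : (⨆ r, F r) < α) : ¬ FourierControl.ExpStabilizableAtRate F hω α := by
    obtain ⟨a, ha⟩ := hbdd
    obtain ⟨b, hb⟩ := habove
    have hC (r : ℝ≥0) : |F r| ≤ max |a| |b| :=
      abs_le_max_abs_abs (ha (mem_range_self r)) (hb (mem_range_self r))
    obtain ⟨lam, hlam, e, he⟩ :=
      FourierControl.exists_tendsto_radialSymbol_add_nsmul n ⟨b, hb⟩ hlim
    exact FourierControl.not_expStabilizableAtRate_of_tendsto hF hC hω hdense (hlam.trans_lt hα) he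
  have hLsup : L ≤ ⨆ r, F r := le_of_tendsto' hlim fun r => le_ciSup habove r
  exact ⟨habove, hmain, fun h => hmain _ (lt_add_one _) (h _ (by linarith))⟩
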